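/- For an integer $n\ge 2$ and $p\in[0,1]$ let $G(n,p)$ denote the Erdős–Rényi random graph on the vertex set $[n]=\{1,\dots,n\}$, in which each of the $\binom n2$ possible edges appears independently with probability $p$. For every $\varepsilon>0$ there exist constants $\Delta>0$, $c>0$ and $\beta>0$, depending only on $\varepsilon$, such that for every integer $n\ge 2$ and every $p$ with $\frac{\varepsilon\log n}{n}\le p\le\frac12$, the following holds with probability at least $1-c\,n^{-\beta}$ for $G$ drawn from $G(n,p)$: if $$\min_{i\in[n]}\deg(i)\ \ge\ \frac{\Delta}{\sqrt{\log n}}\,\mathbb E\deg(i),$$ then $G$ is connected. (The expected degree $\mathbb E\deg(i)$ is the same for every vertex $i$.) -/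

import Mathlib

open MeasureTheory SimpleGraph

open Classical in
/-- The expected degree of the vertex `i` of an Erdős–Rényi random graph on the vertices
`0, …, n - 1` with edge probability `p`. -/
noncomputable def expectedDegree (n : ℕ) (p : unitInterval) (i : Fin n) : ℝ :=
  ∫ G : SimpleGraph (Fin n), (G.degree i : ℝ) ∂(SimpleGraph.binomialRandom (Fin n) p)

open Classical in
/-- The event that `G` is connected if its minimum degree is at least
`Δ / √(log n)` times the expected degree of the vertex `i` (the same number for every `i`). -/
def minDegreeForcesConnected (n : ℕ) (p : unitInterval) (Δ : ℝ) (i : Fin n) :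
    Set (SimpleGraph (Fin n)) :=
  {G | Δ / √(Real.log n) * expectedDegree n p i ≤ (G.minDegree : ℝ) → G.Connected}

/-! A disconnected graph has a nonempty vertex set `S`, `|S| = k ≤ n/2`, with no edge leaving it;
large minimum degree then forces many edges inside `S`. With `L = log n` and `ε ≤ 1`, each such `S`
has probability at most `n⁻² / n.choose k`, so a union bound over `S` gives at most `1/n`.

If `k > n^(1 - ε/4)`, an empty cut is unlikely enough (`choose_mul_one_sub_pow_le`). If `k ≤ n^(1 -
ε/4)`, a Chernoff bound with parameter `t = n^(ε/4)` shows that `S` is unlikely to span `k(n-1)p /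
(2√L)` edges: the gain has order `ε k n p √L`, against a cost of order `k n p + k L`
(`choose_mul_exp_le`). -/

instance SimpleGraph.instMeasurableSingletonClassOfFinite {V : Type*} [Finite V] :
    MeasurableSingletonClass (SimpleGraph V) where
  measurableSet_singleton G := by
    have h : ({G} : Set (SimpleGraph V)) = edgeSet ⁻¹' {G.edgeSet} := by
      ext H
      simp
    rw [h]
    exact measurableEmbedding_edgeSet.measurable (measurableSet_singleton _)

/-! ### Edge counts and expected degree in the random graph. -/

/-- The number of edges of a binomial random graph in a fixed set `A` of potential edges has
the probability generating function of a binomial distribution. -/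
theorem integral_pow_card_edgeSet_inter {V : Type*} [Fintype V] [DecidableEq V]
    (p : unitInterval) (A : Finset (Sym2 V)) (hA : ∀ e ∈ A, ¬ e.IsDiag) (x : ℝ) :
    ∫ G, x ^ (G.edgeSet ∩ A).ncard ∂(binomialRandom V p) = (1 - p + p * x) ^ A.card := by
  classical
  have hmeas : Measurable (fun q : Sym2 V → Prop => {e | q e}) :=
    MeasurableEquiv.setOfPred.measurable
  rw [binomialRandom_eq_map, integral_map measurable_fromEdgeSet.aemeasurable
    (Measurable.of_discrete.aestronglyMeasurable), ProbabilityTheory.setBernoulli_eq_map,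
    integral_map hmeas.aemeasurable (Measurable.of_discrete.aestronglyMeasurable),
    Measure.infinitePi_eq_pi]
  have hprod : ∀ q : Sym2 V → Prop,
      x ^ ((fromEdgeSet {e | q e}).edgeSet ∩ A).ncard
        = ∏ e, (if q e ∧ e ∈ A then x else 1) := by
    intro q
    rw [Finset.prod_ite, Finset.prod_const_one, mul_one, Finset.prod_const,
      ← Set.ncard_coe_finset]
    congr 2
    ext e
    simp only [edgeSet_fromEdgeSet, Finset.coe_filter]
    have := hA e
    simp
    tauto
  simp only [hprod]
  rw [integral_fintype_prod_eq_prod (fun e (r : Prop) => if r ∧ e ∈ A then x else (1:ℝ))]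
  -- The atom of mass `p` lies at `True` only off the diagonal, so `hA` is what makes the factor `1
  -- - p + p * x`.
  have hfac : ∀ e : Sym2 V, (∫ r : Prop, (if r ∧ e ∈ A then x else (1:ℝ))
      ∂(unitInterval.toNNReal p • Measure.dirac (e ∈ (Sym2.diagSetᶜ : Set (Sym2 V))) +
        unitInterval.toNNReal (unitInterval.symm p) • Measure.dirac False))
      = if e ∈ A then (1 - p + p * x : ℝ) else 1 := by
    intro e
    rw [integral_add_measure .of_finite .of_finite, integral_smul_nnreal_measure,
      integral_smul_nnreal_measure, integral_dirac, integral_dirac]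
    have := hA e
    by_cases he : e ∈ A
    · simp [he, this he, NNReal.smul_def]; ring
    · simp [he, NNReal.smul_def]
  simp only [hfac]
  rw [Finset.prod_ite]
  simp

theorem measureReal_edgeSet_inter_eq_empty {V : Type*} [Fintype V] [DecidableEq V]
    (p : unitInterval) (A : Finset (Sym2 V)) (hA : ∀ e ∈ A, ¬ e.IsDiag) :
    (binomialRandom V p).real {G | ∀ e ∈ A, e ∉ G.edgeSet} = (1 - p : ℝ) ^ A.card := by
  classical
  -- Since `0 ^ 0 = 1`, the power `0 ^ N` is the indicator of `N = 0`.
  have h := integral_pow_card_edgeSet_inter p A hA 0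
  rw [mul_zero, add_zero] at h
  rw [← h, ← integral_indicator_one (Set.toFinite _).measurableSet]
  congr 1
  ext G
  have : (∀ e ∈ A, e ∉ G.edgeSet) ↔ (G.edgeSet ∩ A).ncard = 0 := by
    rw [Set.ncard_eq_zero (Set.toFinite _), Set.eq_empty_iff_forall_notMem]
    simp; tauto
  by_cases hG : (G.edgeSet ∩ A).ncard = 0
  · simp [Set.indicator, this, hG]
  · simp [Set.indicator, this, hG]

/-- Chernoff's method: Markov's inequality for `t ^ N`, then `1 - p + p * t ≤ exp (p * t)`. -/
theorem measureReal_le_card_edgeSet_inter {V : Type*} [Fintype V] [DecidableEq V]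
    (p : unitInterval) (A : Finset (Sym2 V)) (hA : ∀ e ∈ A, ¬ e.IsDiag) (a t : ℝ) (ht : 1 ≤ t) :
    (binomialRandom V p).real {G | a ≤ (G.edgeSet ∩ A).ncard}
      ≤ Real.exp (-(a * Real.log t) + A.card * (p * t)) := by
  classical
  have ht0 : 0 < t := by linarith
  have h1 : (binomialRandom V p).real {G | a ≤ (G.edgeSet ∩ A).ncard}
      ≤ ∫ G, t ^ (-a) * t ^ (G.edgeSet ∩ A).ncard ∂(binomialRandom V p) := by
    rw [← integral_indicator_one (Set.toFinite _).measurableSet]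
    refine integral_mono .of_finite .of_finite fun G => ?_
    by_cases hG : a ≤ (G.edgeSet ∩ A).ncard
    · rw [Set.indicator_of_mem (by exact hG)]
      simp only [Pi.one_apply]
      rw [← Real.rpow_natCast, ← Real.rpow_add ht0]
      exact Real.one_le_rpow ht (by linarith)
    · rw [Set.indicator_of_notMem (by exact hG)]
      positivity
  refine h1.trans ?_
  rw [integral_const_mul, integral_pow_card_edgeSet_inter p A hA, Real.exp_add,
    Real.rpow_def_of_pos ht0, mul_comm (Real.log t), neg_mul, Real.exp_nat_mul]
  have := p.2.1
  have := p.2.2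
  have h2 : (1 - p + p * t : ℝ) ≤ Real.exp (p * t) := by
    have := Real.add_one_le_exp ((p : ℝ) * t)
    linarith
  gcongr

theorem expectedDegree_eq (n : ℕ) (p : unitInterval) (i : Fin n) :
    expectedDegree n p i = (n - 1) * p := by
  classical
  have hadj : ∀ j ∈ Finset.univ.erase i,
      ∫ G : SimpleGraph (Fin n), (if G.Adj i j then (1:ℝ) else 0) ∂(binomialRandom (Fin n) p)
        = p := by
    intro j hj
    have h := integral_pow_card_edgeSet_inter p {s(i, j)}
      (by simpa using (Finset.ne_of_mem_erase hj).symm) 0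
    have h2 : ∀ G : SimpleGraph (Fin n), (if G.Adj i j then (1:ℝ) else 0)
        = 1 - 0 ^ (G.edgeSet ∩ (({s(i, j)} : Finset (Sym2 (Fin n))) : Set _)).ncard := by
      intro G
      by_cases hG : G.Adj i j
      · rw [Finset.coe_singleton, Set.inter_eq_right.2 (by simpa using hG)]
        simp [hG]
      · rw [Finset.coe_singleton, Set.inter_singleton_eq_empty.2 (by simpa using hG)]
        simp [hG]
    simp only [h2]
    rw [integral_sub .of_finite .of_finite, h]
    simp
  unfold expectedDegree
  have hdeg : ∀ G : SimpleGraph (Fin n), (G.degree i : ℝ)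
      = ∑ j ∈ Finset.univ.erase i, if G.Adj i j then (1:ℝ) else 0 := by
    intro G
    rw [Finset.sum_boole, ← card_neighborFinset_eq_degree]
    congr 2
    ext j
    simp only [mem_neighborFinset, Finset.mem_filter, Finset.mem_erase, Finset.mem_univ]
    exact ⟨fun h => ⟨⟨h.ne', trivial⟩, h⟩, fun h => h.2⟩
  calc _ = ∫ G : SimpleGraph (Fin n), ∑ j ∈ Finset.univ.erase i, (if G.Adj i j then (1:ℝ) else 0)
        ∂(binomialRandom (Fin n) p) := by
        congr 1; ext G; rw [← hdeg G]
    _ = _ := by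
      rw [integral_finsetSum _ fun _ _ => .of_finite, Finset.sum_congr rfl hadj]
      have : 1 ≤ n := by have := i.2; omega
      simp [Nat.cast_sub this]

/-! ### Edges inside and across a vertex set. -/

/-- The potential edges with both ends in `S`. -/
def innerPairs {V : Type*} [DecidableEq V] (S : Finset V) : Finset (Sym2 V) :=
  S.offDiag.image (fun x => s(x.1, x.2))

/-- The potential edges with exactly one end in `S`. -/
def cutPairs {V : Type*} [Fintype V] [DecidableEq V] (S : Finset V) : Finset (Sym2 V) :=
  (S ×ˢ Sᶜ).image (fun x => s(x.1, x.2))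

theorem not_isDiag_of_mem_innerPairs {V : Type*} [DecidableEq V] {S : Finset V} :
    ∀ e ∈ innerPairs S, ¬ e.IsDiag := by
  intro e he
  obtain ⟨x, hx, rfl⟩ := Finset.mem_image.1 he
  simpa using (Finset.mem_offDiag.1 hx).2.2

theorem not_isDiag_of_mem_cutPairs {V : Type*} [Fintype V] [DecidableEq V] {S : Finset V} :
    ∀ e ∈ cutPairs S, ¬ e.IsDiag := by
  intro e he
  obtain ⟨x, hx, rfl⟩ := Finset.mem_image.1 he
  rw [Finset.mem_product, Finset.mem_compl] at hx
  simp only [Sym2.mk_isDiag_iff]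
  intro h
  exact hx.2 (h ▸ hx.1)

theorem card_innerPairs {V : Type*} [DecidableEq V] (S : Finset V) :
    (innerPairs S).card = S.card.choose 2 :=
  Sym2.card_image_offDiag S

theorem card_cutPairs {V : Type*} [Fintype V] [DecidableEq V] (S : Finset V) :
    (cutPairs S).card = S.card * Sᶜ.card := by
  rw [cutPairs, Finset.card_image_of_injOn, Finset.card_product]
  rintro ⟨a, b⟩ hx ⟨c, d⟩ hy h
  simp only [Finset.coe_product, Set.mem_prod, Finset.mem_coe, Finset.mem_compl] at hx hy
  simp only [Sym2.eq_iff] at h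
  rcases h with ⟨rfl, rfl⟩ | ⟨rfl, rfl⟩
  · rfl
  · exact absurd hx.1 hy.2

/-- With an empty cut, each edge at a vertex of `S` stays in `S` and comes from at most two ordered
pairs. -/
theorem sum_degree_le_two_mul_card_innerPairs {V : Type*} [Fintype V] [DecidableEq V]
    (G : SimpleGraph V) [DecidableRel G.Adj] (S : Finset V) (hcut : ∀ e ∈ cutPairs S, e ∉ G.edgeSet) :
    ∑ v ∈ S, G.degree v ≤ 2 * (G.edgeSet ∩ innerPairs S).ncard := by
  have h1 : ∑ v ∈ S, G.degree v = (S.offDiag.filter fun x => G.Adj x.1 x.2).card := by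
    simp only [← card_neighborFinset_eq_degree]
    rw [← Finset.card_sigma]
    refine Finset.card_bij (fun x _ => (x.1, x.2)) ?_ ?_ ?_
    · rintro ⟨a, b⟩ hx
      simp only [Finset.mem_sigma, mem_neighborFinset] at hx
      simp only [Finset.mem_filter, Finset.mem_offDiag]
      refine ⟨⟨hx.1, ?_, hx.2.ne⟩, hx.2⟩
      by_contra hb
      exact hcut s(a, b) (Finset.mem_image.2 ⟨(a, b), by simp [hx.1, hb], rfl⟩)
        (by simpa using hx.2)
    · rintro ⟨a, b⟩ _ ⟨c, d⟩ _ h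
      simpa using h
    · rintro ⟨a, b⟩ hx
      simp only [Finset.mem_filter, Finset.mem_offDiag] at hx
      exact ⟨⟨a, b⟩, by simp [hx.1.1, hx.2], rfl⟩
  have h2 : (G.edgeSet ∩ innerPairs S).ncard
      = ((innerPairs S).filter (· ∈ G.edgeSet)).card := by
    rw [← Set.ncard_coe_finset]
    congr 1
    ext e
    simp [and_comm]
  rw [h1, h2]
  refine Finset.card_le_mul_card_image_of_maps_to (f := fun x : V × V => s(x.1, x.2)) ?_ 2 ?_
  · rintro x hx
    simp only [Finset.mem_filter] at hx ⊢
    exact ⟨Finset.mem_image_of_mem _ hx.1, by simpa using hx.2⟩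
  · intro e _
    induction e with
    | _ a b =>
      refine (Finset.card_le_card (t := {(a, b), (b, a)}) ?_).trans Finset.card_le_two
      rintro ⟨c, d⟩ hx
      simpa using (Finset.mem_filter.1 hx).2

/-- Take the smaller of a connected component and its complement. -/
theorem exists_isolated_finset_of_not_connected {V : Type*} [Fintype V] [DecidableEq V]
    [Nonempty V] (G : SimpleGraph V) (hG : ¬ G.Connected) :
    ∃ S : Finset V, S.Nonempty ∧ 2 * S.card ≤ Fintype.card V ∧
      ∀ e ∈ cutPairs S, e ∉ G.edgeSet := by
  classical
  have hpre : ¬ G.Preconnected := fun h => hG ⟨h⟩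
  simp only [SimpleGraph.Preconnected, not_forall] at hpre
  obtain ⟨u, v, huv⟩ := hpre
  let C : Finset V := Finset.univ.filter (G.Reachable u)
  have hC : ∀ a ∈ C, ∀ b ∉ C, ¬ G.Adj a b := by
    intro a ha b hb hab
    simp only [C, Finset.mem_filter, Finset.mem_univ, true_and] at ha hb
    exact hb (ha.trans hab.reachable)
  have hcard := Finset.card_add_card_compl C
  rcases le_total C.card Cᶜ.card with h | h
  · refine ⟨C, ⟨u, by simp [C]⟩, by omega, fun e he => ?_⟩
    obtain ⟨x, hx, rfl⟩ := Finset.mem_image.1 he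
    rw [Finset.mem_product, Finset.mem_compl] at hx
    simpa using hC _ hx.1 _ hx.2
  · refine ⟨Cᶜ, ⟨v, by simpa [C] using huv⟩, by omega, fun e he => ?_⟩
    obtain ⟨x, hx, rfl⟩ := Finset.mem_image.1 he
    rw [Finset.mem_product, compl_compl, Finset.mem_compl] at hx
    simpa using fun h => hC _ hx.2 _ hx.1 h.symm

/-! ### Numerical estimates for the union bound. -/

theorem choose_le_exp_mul_one_add_log (n k : ℕ) (hk : 1 ≤ k) (hn : 1 ≤ n) :
    (n.choose k : ℝ) ≤ Real.exp (k * (1 + Real.log n - Real.log k)) := by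
  have hk0 : (0 : ℝ) < k := by exact_mod_cast hk
  have hn0 : (0 : ℝ) < n := by exact_mod_cast hn
  have h1 : (n.choose k : ℝ) ≤ n ^ k / k.factorial := Nat.choose_le_pow_div k n
  have h2 : (k : ℝ) ^ k / k.factorial ≤ Real.exp k := Real.pow_div_factorial_le_exp k hk0.le k
  have h3 : Real.exp (k * (1 + Real.log n - Real.log k)) = Real.exp k * n ^ k / k ^ k := by
    rw [show k * (1 + Real.log n - Real.log k) = k + k * Real.log n - k * Real.log k by ring,
      Real.exp_sub, Real.exp_add, Real.exp_nat_mul, Real.exp_nat_mul, Real.exp_log hn0,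
      Real.exp_log hk0]
  rw [h3]
  refine h1.trans ?_
  have hf : (0 : ℝ) < k.factorial := by exact_mod_cast k.factorial_pos
  rw [div_le_iff₀ hf] at h2
  rw [div_le_div_iff₀ hf (by positivity)]
  calc (n : ℝ) ^ k * k ^ k ≤ n ^ k * (Real.exp k * k.factorial) := by gcongr
    _ = _ := by ring

/-- Large sets: the number of choices is at most `exp (k (1 + ε L / 4))`, while an empty cut costs
`exp (-k ε L / 2)`. -/
theorem choose_mul_one_sub_pow_le (ε p : ℝ) (hε : 0 < ε) (hε1 : ε ≤ 1) (n k : ℕ) (hn : 2 ≤ n)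
    (hk : 1 ≤ k) (hkn : 2 * k ≤ n) (hL : (56 / ε ^ 2) ^ 2 ≤ Real.log n)
    (hp : ε * Real.log n / n ≤ p) (hp1 : p ≤ 1)
    (hlarge : (1 - ε / 4) * Real.log n < Real.log k) :
    n.choose k * (1 - p) ^ (k * (n - k)) ≤ Real.exp (-(2 * Real.log n)) := by
  have hk0 : (0 : ℝ) < k := by exact_mod_cast hk
  have hn0 : (0 : ℝ) < n := by positivity
  have hkn' : (2 : ℝ) * k ≤ n := by exact_mod_cast hkn
  set L := Real.log n with hLdef
  have hL' : 56 ^ 2 ≤ L * ε ^ 4 := by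
    rw [div_pow, div_le_iff₀ (by positivity)] at hL
    calc (56 : ℝ) ^ 2 ≤ _ := hL
      _ = _ := by ring
  have hL0 : 0 < L := lt_of_lt_of_le (by positivity) hL
  have hεL : 56 ^ 2 ≤ L * ε := by
    refine hL'.trans (mul_le_mul_of_nonneg_left ?_ hL0.le)
    exact pow_le_of_le_one hε.le hε1 (by norm_num)
  have hεL2 : 56 ^ 2 ≤ L * ε ^ 2 := by
    refine hL'.trans (mul_le_mul_of_nonneg_left ?_ hL0.le)
    exact pow_le_pow_of_le_one hε.le hε1 (by norm_num)
  have hkε : 16 ≤ k * ε := by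
    have h1 : Real.log k ≤ k := (Real.log_le_sub_one_of_pos hk0).trans (by linarith)
    have h2 : L * (3 / 4) ≤ k := by nlinarith
    nlinarith
  have hpow : (1 - p) ^ (k * (n - k)) ≤ Real.exp (-(k * (ε * L) / 2)) := by
    calc (1 - p) ^ (k * (n - k)) ≤ Real.exp (-p) ^ (k * (n - k)) :=
          pow_le_pow_left₀ (by linarith) (by linarith [Real.add_one_le_exp (-p)]) _
      _ = Real.exp ((k * (n - k) : ℝ) * -p) := by
          rw [← Real.exp_nat_mul, Nat.cast_mul, Nat.cast_sub (by omega)]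
      _ ≤ _ := by
          refine Real.exp_le_exp.2 ?_
          rw [div_le_iff₀ hn0] at hp
          have hp0 : 0 ≤ p := by
            by_contra h
            nlinarith [mul_pos hε hL0]
          have : ε * L / 2 ≤ (n - k) * p := by nlinarith
          nlinarith
  calc n.choose k * (1 - p) ^ (k * (n - k))
      ≤ Real.exp (k * (1 + L - Real.log k)) * Real.exp (-(k * (ε * L) / 2)) :=
        mul_le_mul (choose_le_exp_mul_one_add_log n k hk (by omega)) hpow
          (pow_nonneg (by linarith) _) (Real.exp_pos _).le
    _ = Real.exp (k * (1 + L - Real.log k) - k * (ε * L) / 2) := by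
        rw [← Real.exp_add]; ring_nf
    _ ≤ _ := by
        refine Real.exp_le_exp.2 ?_
        have h1 : 1 + L - Real.log k ≤ 1 + ε / 4 * L := by linarith
        have h2 := mul_le_mul_of_nonneg_left h1 hk0.le
        -- Of the surplus `k ε L / 4`, one half absorbs the term `k` and the other is at least `2
        -- L`.
        have h3 : k * (8 : ℝ) ≤ k * (ε * L) := by gcongr; linarith
        have h4 : 16 * L ≤ k * ε * L := by gcongr
        nlinarith

/-- Small sets: `k * n^(ε/4) ≤ n` keeps the exponential moment term below `k n p / 2`. -/
theorem choose_mul_exp_le (ε p : ℝ) (hε : 0 < ε) (hε1 : ε ≤ 1) (n k : ℕ) (hn : 2 ≤ n)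
    (hk : 1 ≤ k) (hL : (56 / ε ^ 2) ^ 2 ≤ Real.log n)
    (hp : ε * Real.log n / n ≤ p)
    (hsmall : Real.log k ≤ (1 - ε / 4) * Real.log n) :
    n.choose k * Real.exp (-(k * ((n - 1) * p / √(Real.log n)) / 2 * (ε / 4 * Real.log n))
      + k.choose 2 * (p * Real.exp (ε / 4 * Real.log n))) ≤ Real.exp (-(2 * Real.log n)) := by
  have hk0 : (0 : ℝ) < k := by exact_mod_cast hk
  have hk1 : (1 : ℝ) ≤ k := by exact_mod_cast hk
  have hn0 : (0 : ℝ) < n := by positivity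
  have hn2 : (2 : ℝ) ≤ n := by exact_mod_cast hn
  set L := Real.log n with hLdef
  have hL0 : 0 < L := lt_of_lt_of_le (by positivity) hL
  set x := √L with hx
  have hx0 : 0 < x := Real.sqrt_pos.2 hL0
  have hLx : L = x ^ 2 := (Real.sq_sqrt hL0.le).symm
  have hxε : 56 ≤ x * ε ^ 2 := by
    have := Real.le_sqrt_of_sq_le hL
    rwa [div_le_iff₀ (by positivity)] at this
  have hp0 : 0 ≤ p := le_trans (by positivity) hp
  have hnp : ε * L ≤ n * p := by
    rw [div_le_iff₀ hn0] at hp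
    linarith
  have hkt : k * Real.exp (ε / 4 * L) ≤ n := by
    calc k * Real.exp (ε / 4 * L) = Real.exp (Real.log k + ε / 4 * L) := by
          rw [Real.exp_add, Real.exp_log hk0]
      _ ≤ Real.exp L := Real.exp_le_exp.2 (by linarith)
      _ = n := Real.exp_log hn0
  have hchoose : (n.choose k : ℝ) ≤ Real.exp (k * L) := by
    rw [Real.exp_nat_mul, Real.exp_log hn0]
    exact_mod_cast Nat.choose_le_pow n k
  have hchoose2 : (k.choose 2 : ℝ) ≤ k * k / 2 := by
    rw [Nat.cast_choose_two]
    nlinarith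
  have hin : (k.choose 2 : ℝ) * (p * Real.exp (ε / 4 * L)) ≤ k / 2 * (n * p) := by
    calc _ ≤ k * k / 2 * (p * Real.exp (ε / 4 * L)) := by gcongr
      _ = k / 2 * p * (k * Real.exp (ε / 4 * L)) := by ring
      _ ≤ k / 2 * p * n := by gcongr
      _ = _ := by ring
  have hdeg : k / 2 * (n * p) * (ε * x / 8) ≤ k * ((n - 1) * p / x) / 2 * (ε / 4 * L) := by
    have : k * ((n - 1) * p / x) / 2 * (ε / 4 * L) = k / 2 * ((n - 1) * p) * (ε * x / 4) := by
      rw [hLx]; field_simp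
    rw [this]
    calc k / 2 * (n * p) * (ε * x / 8) = k / 2 * (n / 2 * p) * (ε * x / 4) := by ring
      _ ≤ _ := by gcongr; linarith
  -- The source of `56 = 8 * 7`: `ε² x / 8 ≥ 7`, and `ε ≤ 1` is subtracted.
  have hfac : 6 ≤ ε * (ε * x / 8 - 1) := by nlinarith
  have hfac0 : 0 ≤ ε * x / 8 - 1 := by
    by_contra h
    nlinarith
  -- One `k L` pays for the choice of `S`; the other two leave `n⁻²`.
  have hmain : 3 * (k * L) ≤ k / 2 * (n * p) * (ε * x / 8 - 1) := by
    calc 3 * (k * L) = k / 2 * L * 6 := by ring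
      _ ≤ k / 2 * L * (ε * (ε * x / 8 - 1)) := by gcongr
      _ = k / 2 * (ε * L) * (ε * x / 8 - 1) := by ring
      _ ≤ _ := by gcongr
  calc _ ≤ Real.exp (k * L) * Real.exp (-(3 * (k * L))) := by
        gcongr
        linarith
    _ = Real.exp (-(2 * (k * L))) := by rw [← Real.exp_add]; ring_nf
    _ ≤ _ := Real.exp_le_exp.2 (by nlinarith)

/-! ### The union bound and the conclusion. -/

/-- The event that no edge leaves `S` while `S` spans enough edges for every vertex of `S` to have
degree at least `d`. -/
def isolatedDense {V : Type*} [Fintype V] [DecidableEq V] (d : ℝ) (S : Finset V) :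
    Set (SimpleGraph V) :=
  {G | (∀ e ∈ cutPairs S, e ∉ G.edgeSet) ∧ S.card * d / 2 ≤ (G.edgeSet ∩ innerPairs S).ncard}

theorem choose_mul_measureReal_isolatedDense_le (ε : ℝ) (hε : 0 < ε) (hε1 : ε ≤ 1) (n : ℕ)
    (hn : 2 ≤ n) (hL : (56 / ε ^ 2) ^ 2 ≤ Real.log n) (p : unitInterval)
    (hp : ε * Real.log n / n ≤ p) (S : Finset (Fin n)) (hS : S.Nonempty) (hSn : 2 * S.card ≤ n) :
    n.choose S.card * (binomialRandom (Fin n) p).real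
      (isolatedDense ((n - 1) * p / √(Real.log n)) S) ≤ Real.exp (-(2 * Real.log n)) := by
  rcases lt_or_ge ((1 - ε / 4) * Real.log n) (Real.log S.card) with h | h
  · refine le_trans ?_ (choose_mul_one_sub_pow_le ε p hε hε1 n S.card hn hS.card_pos hSn hL hp
      p.2.2 h)
    gcongr
    calc _ ≤ (binomialRandom (Fin n) p).real {G | ∀ e ∈ cutPairs S, e ∉ G.edgeSet} :=
          measureReal_mono fun G hG => hG.1
      _ = _ := by
        rw [measureReal_edgeSet_inter_eq_empty p _ not_isDiag_of_mem_cutPairs, card_cutPairs,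
          Finset.card_compl, Fintype.card_fin]
  · refine le_trans ?_ (choose_mul_exp_le ε p hε hε1 n S.card hn hS.card_pos hL hp h)
    gcongr
    have hL0 : 0 ≤ Real.log n := Real.log_natCast_nonneg n
    have := measureReal_le_card_edgeSet_inter p (innerPairs S) not_isDiag_of_mem_innerPairs
      (S.card * ((n - 1) * p / √(Real.log n)) / 2) (Real.exp (ε / 4 * Real.log n))
      (Real.one_le_exp (by positivity))
    rw [Real.log_exp, card_innerPairs] at this
    exact (measureReal_mono fun G hG => hG.2).trans this

theorem compl_minDegreeForcesConnected_subset (n : ℕ) (p : unitInterval) (i : Fin n) :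
    (minDegreeForcesConnected n p 1 i)ᶜ ⊆
      ⋃ S ∈ (Finset.univ : Finset (Finset (Fin n))).filter
        (fun S => S.Nonempty ∧ 2 * S.card ≤ n),
        isolatedDense ((n - 1) * p / √(Real.log n)) S := by
  classical
  intro G hG
  simp only [minDegreeForcesConnected, Set.mem_compl_iff, Set.mem_ofPred_eq, Classical.not_imp,
    expectedDegree_eq] at hG
  have : Nonempty (Fin n) := ⟨i⟩
  obtain ⟨S, hS, hSn, hcut⟩ := exists_isolated_finset_of_not_connected G hG.2
  rw [Fintype.card_fin] at hSn
  refine Set.mem_iUnion₂.2 ⟨S, by simp [hS, hSn], hcut, ?_⟩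
  have h1 := sum_degree_le_two_mul_card_innerPairs G S hcut
  have h2 := Finset.card_nsmul_le_sum S (fun v => G.degree v) G.minDegree
    fun v _ => G.minDegree_le_degree v
  rw [smul_eq_mul] at h2
  have h3 : (S.card * G.minDegree : ℝ) ≤ 2 * (G.edgeSet ∩ innerPairs S).ncard := by
    have := h2.trans h1
    exact_mod_cast this
  have h4 : ((n : ℝ) - 1) * p / √(Real.log n) ≤ (G.minDegree : ℝ) := by
    refine le_trans (le_of_eq ?_) hG.1
    ring
  have := mul_le_mul_of_nonneg_left h4 (Nat.cast_nonneg (α := ℝ) S.card)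
  linarith

theorem measureReal_compl_minDegreeForcesConnected_le (ε : ℝ) (hε : 0 < ε) (hε1 : ε ≤ 1) (n : ℕ)
    (hn : 2 ≤ n) (hL : (56 / ε ^ 2) ^ 2 ≤ Real.log n) (p : unitInterval)
    (hp : ε * Real.log n / n ≤ p) (i : Fin n) :
    (binomialRandom (Fin n) p).real (minDegreeForcesConnected n p 1 i)ᶜ ≤ (n : ℝ)⁻¹ := by
  classical
  have hn0 : (0 : ℝ) < n := by positivity
  set B := fun S : Finset (Fin n) => isolatedDense ((n - 1) * p / √(Real.log n)) S
  set q := Real.exp (-(2 * Real.log n)) with hq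
  set F := (Finset.univ : Finset (Finset (Fin n))).filter (fun S => S.Nonempty ∧ 2 * S.card ≤ n)
  calc _ ≤ (binomialRandom (Fin n) p).real (⋃ S ∈ F, B S) :=
        measureReal_mono (compl_minDegreeForcesConnected_subset n p i) (measure_ne_top _ _)
    _ ≤ ∑ S ∈ F, (binomialRandom (Fin n) p).real (B S) := measureReal_biUnion_finset_le _ _
    _ ≤ ∑ S ∈ F, q / n.choose S.card := by
        refine Finset.sum_le_sum fun S hS => ?_
        simp only [F, Finset.mem_filter, Finset.mem_univ, true_and] at hS
        have hpos : (0 : ℝ) < n.choose S.card := by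
          exact_mod_cast Nat.choose_pos (by omega)
        rw [le_div_iff₀' hpos]
        exact choose_mul_measureReal_isolatedDense_le ε hε hε1 n hn hL p hp S hS.1 hS.2
    _ ≤ ∑ S ∈ (Finset.univ : Finset (Fin n)).powerset,
          if S.card = 0 then 0 else q / n.choose S.card := by
        rw [Finset.powerset_univ, Finset.sum_filter]
        refine Finset.sum_le_sum fun S _ => ?_
        rcases S.eq_empty_or_nonempty with rfl | hS
        · simp
        · rw [if_neg hS.card_pos.ne']
          split_ifs
          · exact le_rfl
          · positivity
    _ = ∑ k ∈ Finset.range (n + 1), n.choose k • if k = 0 then 0 else q / n.choose k := by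
        rw [Finset.sum_powerset_apply_card (fun k => if k = 0 then 0 else q / n.choose k),
          Finset.card_univ, Fintype.card_fin]
    -- Each size `1, …, n` contributes exactly `q = n⁻²`.
    _ = ∑ k ∈ Finset.range n, q := by
        rw [Finset.sum_range_succ']
        simp only [if_pos, smul_zero, add_zero]
        refine Finset.sum_congr rfl fun k hk => ?_
        have hpos : (0 : ℝ) < n.choose (k + 1) := by
          exact_mod_cast Nat.choose_pos (by have := Finset.mem_range.1 hk; omega)
        rw [if_neg k.succ_ne_zero, nsmul_eq_mul]
        field_simp
    _ = (n : ℝ)⁻¹ := by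
        rw [Finset.sum_const, Finset.card_range, nsmul_eq_mul, hq, Real.exp_neg, two_mul,
          Real.exp_add, Real.exp_log hn0]
        field_simp

theorem mainTheorem7 (ε : ℝ) (hε : 0 < ε) :
    ∃ Δ : ℝ, 0 < Δ ∧ ∃ c : ℝ, 0 < c ∧ ∃ β : ℝ, 0 < β ∧
      ∀ n : ℕ, 2 ≤ n → ∀ p : unitInterval,
        ε * Real.log n / n ≤ (p : ℝ) → (p : ℝ) ≤ 1 / 2 →
          ∀ i : Fin n,
            1 - c * (n : ℝ) ^ (-β) ≤
              (SimpleGraph.binomialRandom (Fin n) p).real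
                (minDegreeForcesConnected n p Δ i) := by
  -- With this `c`, the bound is trivial for `n` below the threshold, as then `c / n ≥ 1`. Replacing
  -- `ε` by `min ε 1` only weakens the lower bound on `p`.
  refine ⟨1, one_pos, Real.exp ((56 / (min ε 1) ^ 2) ^ 2), Real.exp_pos _, 1, one_pos, ?_⟩
  intro n hn p hp _ i
  have hn0 : (0 : ℝ) < n := by positivity
  rw [Real.rpow_neg_one]
  rcases le_or_gt ((56 / (min ε 1) ^ 2) ^ 2) (Real.log n) with hL | hL
  · have hp' : min ε 1 * Real.log n / n ≤ p := by
      refine le_trans ?_ hp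
      gcongr
      exact min_le_left _ _
    have h := measureReal_compl_minDegreeForcesConnected_le (min ε 1) (lt_min hε one_pos)
      (min_le_right _ _) n hn hL p hp' i
    rw [probReal_compl_eq_one_sub (Set.toFinite _).measurableSet] at h
    have hc : 1 * (n : ℝ)⁻¹ ≤ Real.exp ((56 / (min ε 1) ^ 2) ^ 2) * (n : ℝ)⁻¹ := by
      gcongr
      exact Real.one_le_exp (by positivity)
    linarith
  · have h1 : (n : ℝ) ≤ Real.exp ((56 / (min ε 1) ^ 2) ^ 2) := by
      rw [← Real.log_le_iff_le_exp hn0]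
      exact hL.le
    have h2 : 1 ≤ Real.exp ((56 / (min ε 1) ^ 2) ^ 2) * (n : ℝ)⁻¹ := by
      rw [← div_eq_mul_inv, le_div_iff₀ hn0]
      linarith
    have h3 : 0 ≤ (binomialRandom (Fin n) p).real (minDegreeForcesConnected n p 1 i) :=
      measureReal_nonneg
    linarith
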